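/- All graphs are simple and undirected. The line graph $L(G)$ of a graph $G$ has the edges of $G$ as its vertices, two of them being adjacent if they are distinct and share an endpoint; $L^0(G)=G$ and $L^{k+1}(G)=L(L^k(G))$. A graph is called prolific if it is finite and connected and is not isomorphic to a path $P_n$ ($n\ge 1$), a cycle $C_n$ ($n\ge 3$), or the star $K_{1,3}$. Let $\chi$ denote the chromatic number, put $\mathrm{ind}(\chi,G)=\min\{r : \chi(G)<\chi(L^r(G))\}$, and let $k(\chi,\mathcal F)=\max\{\mathrm{ind}(\chi,G) : G\in\mathcal F\}$, where $\mathcal F$ is the family of all prolific graphs (a minimum over the empty set, and a maximum that does not exist, are read as $\infty$). For $k\ge 3$ and $l\ge 1$ let $CP(k,l)$ be the graph on $k+l$ vertices obtained from a cycle $C_k$ by attaching a path of length $l$ at one of its vertices. Theorem H. Every prolific graph $G$ satisfies $\mathrm{ind}(\chi,G)\le 3$. For every $n\ge 4$ the graph $CP(3,n-3)$ is prolific and $\mathrm{ind}(\chi,CP(3,n-3))=3$; in particular there are infinitely many pairwise non-isomorphic prolific graphs $G$ with $\mathrm{ind}(\chi,G)=3$. Hence $k(\chi,\mathcal F)=3$.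 -/

import Mathlib

universe u

namespace LineIndex

/-- A simple graph bundled with its vertex type. -/
abbrev Graph : Type (u + 1) := Σ V : Type u, SimpleGraph V

/-- The iterated line graph: `L^0(G) = G` and `L^(k+1)(G) = L(L^k(G))`. -/
def iterLine (G : Graph.{u}) : ℕ → Graph.{u}
  | 0 => G
  | k + 1 => ⟨(iterLine G k).2.edgeSet, (iterLine G k).2.lineGraph⟩

/-- A finite connected simple graph that is not isomorphic to a path, to a cycle, or to `K_{1,3}`. -/
def IsProlific {V : Type u} (G : SimpleGraph V) : Prop :=
  Finite V ∧ G.Connected ∧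
    (∀ n : ℕ, IsEmpty (G ≃g SimpleGraph.pathGraph n)) ∧
    (∀ n : ℕ, 3 ≤ n → IsEmpty (G ≃g SimpleGraph.cycleGraph n)) ∧
    IsEmpty (G ≃g completeBipartiteGraph (Fin 1) (Fin 3))

/-- The family of all prolific graphs. -/
def prolificGraphs : Set Graph.{u} := {G | IsProlific G.2}

/-- `ind(P, G) = min {r : P(G) < P(L^r(G))}`, with value `⊤` if there is no such `r`. -/
noncomputable def ind (P : Graph.{u} → ℕ∞) (G : Graph.{u}) : ℕ∞ :=
  sInf ((fun r : ℕ => (r : ℕ∞)) '' {r : ℕ | P G < P (iterLine G r)})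

/-- The index `k(P, F)` of a family: the maximum of `ind(P, G)` over `G ∈ F`, and `⊤` if the
indices are unbounded or some index is infinite. (In `ℕ∞` a supremum of a nonempty set that is
not `⊤` is attained.) -/
noncomputable def familyIndex (P : Graph.{u} → ℕ∞) (F : Set Graph.{u}) : ℕ∞ :=
  ⨆ G ∈ F, ind P G

/-- The chromatic number as a graph parameter. -/
noncomputable def chi (G : Graph.{u}) : ℕ∞ := G.2.chromaticNumber

/-- `CP(k, l)` for `k ≥ 3`: the path `0, 1, …, k + l - 1` together with the edge joining `0` and
`k - 1`. So `0, …, k - 1` is a `k`-cycle, to whose vertex `k - 1` a path of length `l` is attached. -/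
def CP (k l : ℕ) : SimpleGraph (Fin (k + l)) :=
  SimpleGraph.fromRel fun i j =>
    (i : ℕ) + 1 = (j : ℕ) ∨ ((i : ℕ) = 0 ∧ (j : ℕ) + 1 = k)

end LineIndex

/-!
The edges at a vertex form a clique of the line graph, so `χ(L(G))` is at least every degree of
`G`, and a pair of adjacent edges of `G` gives a vertex of `L(L(G))` whose degree is determined by
the degrees of the three vertices involved.

Let `χ(G) = c`. If `c < 3`, a vertex of degree at least three gives `χ(L(G)) ≥ 3 > c`. If `c ≥ 3`,
then `G` contains a finite subgraph of minimum degree at least `c - 1` (a vertex-critical one, by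
the theorem of de Bruijn and Erdős if `G` is infinite). As `G` is connected and has a vertex of
degree at least three, some vertex `v` of the subgraph has degree at least `max 3 (c - 1)` in `G`.
Two edges `va`, `vb` of the subgraph then form a vertex of `L(L(G))` of degree at least
`2 max(3, c - 1) + 2 (c - 1) - 6 > c`, whence `χ(L³(G)) > c`.

A prolific graph has a vertex of degree at least three, since a finite connected graph of maximum
degree at most two is a path or a cycle: a longest path or a cycle in it meets every edge at its
vertices, and so covers the graph.

The graph `CP(3, l)` contains a triangle, while its line graph and its second line graph are
three-colourable: it lies in the ray `0, 1, 2, …` with the chord `02`, whose line graph lies in the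
ray with the two chords `02` and `13`.
-/

namespace LineIndex

open SimpleGraph

section LineGraph

variable {V : Type*} {G : SimpleGraph V}

theorem exists_eq_mk_of_lineGraph_adj {e e' : G.edgeSet} (h : G.lineGraph.Adj e e') :
    ∃ a b c, G.Adj a b ∧ G.Adj a c ∧ b ≠ c ∧ e.1 = s(a, b) ∧ e'.1 = s(a, c) := by
  obtain ⟨hne, a, ha, ha'⟩ := lineGraph_adj_iff_exists.1 h
  obtain ⟨b, hb⟩ := Sym2.mem_iff_exists.1 ha
  obtain ⟨c, hc⟩ := Sym2.mem_iff_exists.1 ha'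
  have hab : s(a, b) ∈ G.edgeSet := hb ▸ e.2
  have hac : s(a, c) ∈ G.edgeSet := hc ▸ e'.2
  refine ⟨a, b, c, hab, hac, ?_, hb, hc⟩
  rintro rfl
  exact hne (Subtype.ext (hb.trans hc.symm))

theorem lineGraph_adj_mk {a b c : V} (hb : G.Adj a b) (hc : G.Adj a c) (hbc : b ≠ c) :
    G.lineGraph.Adj ⟨s(a, b), hb⟩ ⟨s(a, c), hc⟩ :=
  lineGraph_adj_iff_exists.2
    ⟨fun h => hbc (Sym2.congr_right.1 (congrArg Subtype.val h)), a, by simp, by simp⟩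

theorem encard_incidenceSet (v : V) :
    (G.incidenceSet v).encard = (G.neighborSet v).encard := by
  classical exact ENat.card_congr (G.incidenceSetEquivNeighborSet v)

theorem encard_neighborSet_le_chromaticNumber_lineGraph (v : V) :
    (G.neighborSet v).encard ≤ G.lineGraph.chromaticNumber := by
  let star : (⊤ : SimpleGraph (G.incidenceSet v)) →g G.lineGraph :=
    { toFun e := ⟨e, e.2.1⟩
      map_rel' {e e'} h := lineGraph_adj_iff_exists.2
        ⟨fun he => h.ne (Subtype.ext (Subtype.mk.inj he)), v, e.2.2, e'.2.2⟩ }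
  calc (G.neighborSet v).encard
      = (⊤ : SimpleGraph (G.incidenceSet v)).chromaticNumber := by
        rw [← encard_incidenceSet, chromaticNumber_top_eq_enat_card]; rfl
    _ ≤ G.lineGraph.chromaticNumber := chromaticNumber_mono_of_hom star

theorem image_val_neighborSet_lineGraph {u v : V} (h : G.Adj u v) :
    Subtype.val '' G.lineGraph.neighborSet ⟨s(u, v), h⟩ =
      (G.incidenceSet u ∪ G.incidenceSet v) \ {s(u, v)} := by
  ext e
  constructor
  · rintro ⟨e, he, rfl⟩
    obtain ⟨hne, w, hw, hwe⟩ := lineGraph_adj_iff_exists.1 he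
    refine ⟨?_, fun h => hne (Subtype.ext h.symm)⟩
    rcases Sym2.mem_iff.1 hw with rfl | rfl
    · exact Or.inl ⟨e.2, hwe⟩
    · exact Or.inr ⟨e.2, hwe⟩
  · rintro ⟨⟨he, hue⟩ | ⟨he, hve⟩, hne⟩
    · exact ⟨⟨e, he⟩, lineGraph_adj_iff_exists.2
        ⟨fun h => hne (congrArg Subtype.val h).symm, u, by simp, hue⟩, rfl⟩
    · exact ⟨⟨e, he⟩, lineGraph_adj_iff_exists.2
        ⟨fun h => hne (congrArg Subtype.val h).symm, v, by simp, hve⟩, rfl⟩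

theorem encard_neighborSet_lineGraph_add_two {u v : V} (h : G.Adj u v) :
    (G.lineGraph.neighborSet ⟨s(u, v), h⟩).encard + 2 =
      (G.neighborSet u).encard + (G.neighborSet v).encard := by
  have huv : s(u, v) ∈ G.incidenceSet u ∪ G.incidenceSet v := Or.inl ⟨h, by simp⟩
  calc (G.lineGraph.neighborSet ⟨s(u, v), h⟩).encard + 2
      = ((G.incidenceSet u ∪ G.incidenceSet v) \ {s(u, v)}).encard + 1 + 1 := by
        rw [← image_val_neighborSet_lineGraph h, Subtype.val_injective.encard_image, add_assoc,
          one_add_one_eq_two]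
    _ = (G.incidenceSet u ∪ G.incidenceSet v).encard +
          (G.incidenceSet u ∩ G.incidenceSet v).encard := by
        rw [Set.encard_sdiff_singleton_add_one huv, G.incidenceSet_inter_incidenceSet_of_adj h,
          Set.encard_singleton]
    _ = (G.neighborSet u).encard + (G.neighborSet v).encard := by
        rw [Set.encard_union_add_encard_inter, encard_incidenceSet, encard_incidenceSet]

/-- In the third line graph the left-hand side, less six, is the size of the clique formed by the
edges at the vertex `{va, vb}` of the second one. -/
theorem two_mul_encard_add_le_chromaticNumber_lineGraph_three {v a b : V} (hab : a ≠ b)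
    (ha : G.Adj v a) (hb : G.Adj v b) :
    2 * (G.neighborSet v).encard + (G.neighborSet a).encard + (G.neighborSet b).encard ≤
      G.lineGraph.lineGraph.lineGraph.chromaticNumber + 6 := by
  calc 2 * (G.neighborSet v).encard + (G.neighborSet a).encard + (G.neighborSet b).encard
      = ((G.neighborSet v).encard + (G.neighborSet a).encard) +
          ((G.neighborSet v).encard + (G.neighborSet b).encard) := by ring
    _ = (G.lineGraph.neighborSet ⟨s(v, a), ha⟩).encard +
          (G.lineGraph.neighborSet ⟨s(v, b), hb⟩).encard + 4 := by
        rw [← encard_neighborSet_lineGraph_add_two ha, ← encard_neighborSet_lineGraph_add_two hb]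
        ring
    _ = (G.lineGraph.lineGraph.neighborSet ⟨s(_, _), lineGraph_adj_mk ha hb hab⟩).encard + 6 := by
        rw [← encard_neighborSet_lineGraph_add_two (lineGraph_adj_mk ha hb hab)]
        ring
    _ ≤ G.lineGraph.lineGraph.lineGraph.chromaticNumber + 6 := by
        gcongr
        exact encard_neighborSet_le_chromaticNumber_lineGraph _

end LineGraph

section Colorable

variable {V : Type*} {G : SimpleGraph V} {k : ℕ}

theorem colorable_induce_insert {s : Set V} {v : V} (hs : (G.induce s).Colorable k)
    (hv : (G.neighborSet v ∩ s).encard < k) : (G.induce (insert v s)).Colorable k := by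
  classical
  obtain ⟨f⟩ := hs
  obtain ⟨c, hc⟩ : ∃ c, ∀ w (hw : w ∈ s), G.Adj v w → f ⟨w, hw⟩ ≠ c := by
    by_contra! hall
    choose g hgs hadj hg using hall
    have hg_inj : Function.Injective fun c => (⟨g c, hadj c, hgs c⟩ : ↥(G.neighborSet v ∩ s)) :=
      fun c d h => by
        have hcd : g c = g d := congrArg Subtype.val h
        rw [← hg c, ← hg d]
        simp only [hcd]
    refine hv.not_ge ?_
    calc (k : ℕ∞) = ENat.card (Fin k) := by simp
      _ ≤ (G.neighborSet v ∩ s).encard := ENat.card_le_card_of_injective hg_inj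
  refine ⟨Coloring.mk (fun x => if hx : x.1 ∈ s then f ⟨x, hx⟩ else c) ?_⟩
  rintro ⟨x, hx⟩ ⟨y, hy⟩ hxy
  have hadj : G.Adj x y := hxy
  by_cases hxs : x ∈ s <;> by_cases hys : y ∈ s <;> simp only [hxs, hys, dite_true, dite_false]
  · exact f.valid hadj
  · exact hc x hxs (hy.resolve_right hys ▸ hadj.symm)
  · exact (hc y hys (hx.resolve_right hxs ▸ hadj)).symm
  · exact absurd ((hx.resolve_right hxs).trans (hy.resolve_right hys).symm) hadj.ne

theorem colorable_of_forall_finset_induce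
    (h : ∀ S : Finset V, (G.induce (S : Set V)).Colorable k) : G.Colorable k := by
  refine nonempty_hom_of_forall_finite_subgraph_hom fun H hH => Classical.choice ?_
  let incl : H.coe →g G.induce (hH.toFinset : Set V) :=
    { toFun x := ⟨x, by simp⟩
      map_rel' hxy := H.adj_sub hxy }
  exact (h hH.toFinset).of_hom incl

/-- Such a set is a minimal one among the finite sets inducing a graph that is not `k`-colourable:
a colouring of the rest would extend to a vertex with fewer than `k` neighbours. -/
theorem exists_finset_le_encard_of_not_colorable (h : ¬ G.Colorable k) :
    ∃ S : Finset V, S.Nonempty ∧ ∀ v ∈ S, (k : ℕ∞) ≤ (G.neighborSet v ∩ S).encard := by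
  classical
  obtain ⟨T, hT⟩ : ∃ S : Finset V, ¬ (G.induce (S : Set V)).Colorable k := by
    by_contra! hall
    exact h (colorable_of_forall_finset_induce hall)
  obtain ⟨S, -, hS⟩ := exists_minimal_le_of_wellFoundedLT
    (fun S : Finset V => ¬ (G.induce (S : Set V)).Colorable k) T hT
  refine ⟨S, Finset.nonempty_iff_ne_empty.2 ?_, fun v hv => ?_⟩
  · rintro rfl
    have : IsEmpty ((∅ : Finset V) : Set V) := by simp
    exact hS.prop (Colorable.of_isEmpty k)
  · by_contra! hlt
    have herase : (G.induce (S.erase v : Set V)).Colorable k :=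
      not_not.1 (hS.not_prop_of_lt (Finset.erase_ssubset hv))
    refine hS.prop ?_
    rw [← Finset.insert_erase hv, Finset.coe_insert]
    exact colorable_induce_insert herase (hlt.trans_le' (Set.encard_le_encard (by grind)))

end Colorable

section PathOrCycle

variable {V W : Type*} {G : SimpleGraph V} {H : SimpleGraph W}

theorem exists_adj_of_encard_le (f : Copy H G) {x : W} (hx : (H.neighborSet x).Finite)
    (hle : (G.neighborSet (f x)).encard ≤ (H.neighborSet x).encard) {w : V}
    (hw : G.Adj (f x) w) : ∃ y, H.Adj x y ∧ f y = w := by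
  have hinj : Function.Injective f := f.injective
  have hsub : f '' H.neighborSet x ⊆ G.neighborSet (f x) := by
    rintro _ ⟨y, hy, rfl⟩
    exact f.toHom.map_adj hy
  have heq : f '' H.neighborSet x = G.neighborSet (f x) :=
    (hx.image f).eq_of_subset_of_encard_le hsub (by rwa [hinj.encard_image])
  exact heq.ge hw

/-- The condition `hf` says that `f` is a covering map. -/
theorem nonempty_iso_of_copy [Nonempty W] (hG : G.Preconnected) (f : Copy H G)
    (hf : ∀ x w, G.Adj (f x) w → ∃ y, H.Adj x y ∧ f y = w) : Nonempty (G ≃g H) := by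
  have hsurj : Function.Surjective f := by
    by_contra hnot
    obtain ⟨w, hw⟩ := not_forall.1 hnot
    obtain ⟨x₀⟩ := ‹Nonempty W›
    obtain ⟨p⟩ := hG (f x₀) w
    obtain ⟨d, -, ⟨x, hx⟩, hd⟩ := p.exists_boundary_dart (Set.range f) ⟨x₀, rfl⟩ hw
    obtain ⟨y, -, hy⟩ := hf x d.snd (hx ▸ d.adj)
    exact hd ⟨y, hy⟩
  have hadj {x y : W} : G.Adj (f x) (f y) ↔ H.Adj x y := by
    refine ⟨fun h => ?_, f.toHom.map_adj⟩
    obtain ⟨z, hz, hzy⟩ := hf x _ h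
    exact f.injective hzy ▸ hz
  let e : H ≃g G := ⟨Equiv.ofBijective f ⟨f.injective, hsurj⟩, hadj⟩
  exact ⟨e.symm⟩

theorem encard_neighborSet_cycleGraph_le_two {n : ℕ} (v : Fin n) :
    ((cycleGraph n).neighborSet v).encard ≤ 2 := by
  match n with
  | 1 => simp
  | n + 2 =>
    rw [cycleGraph_neighborSet]
    exact (Set.encard_insert_le _ _).trans (by simp [one_add_one_eq_two])

theorem encard_neighborSet_pathGraph_le_two {n : ℕ} (v : Fin n) :
    ((pathGraph n).neighborSet v).encard ≤ 2 :=
  (Set.encard_le_encard fun _ h => pathGraph_le_cycleGraph h).trans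
    (encard_neighborSet_cycleGraph_le_two v)

theorem encard_neighborSet_cycleGraph {n : ℕ} (hn : 3 ≤ n) (v : Fin n) :
    ((cycleGraph n).neighborSet v).encard = 2 := by
  obtain ⟨n, rfl⟩ := Nat.exists_eq_add_of_le' hn
  rw [← coe_neighborFinset, Set.encard_coe_eq_coe_finsetCard, card_neighborFinset_eq_degree,
    cycleGraph_degree_three_le, Nat.cast_ofNat]

theorem encard_neighborSet_pathGraph {n : ℕ} {v : Fin n} (hv : 0 < (v : ℕ))
    (hvn : (v : ℕ) + 1 < n) : ((pathGraph n).neighborSet v).encard = 2 := by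
  refine (encard_neighborSet_pathGraph_le_two v).antisymm ?_
  rw [← Set.encard_pair (x := (⟨v - 1, by omega⟩ : Fin n)) (y := ⟨v + 1, hvn⟩) (by simp)]
  refine Set.encard_le_encard (Set.pair_subset ?_ ?_) <;>
    simp only [mem_neighborSet, pathGraph_adj] <;> lia

theorem nonempty_iso_cycleGraph {n : ℕ} (hn : 3 ≤ n) (hG : G.Preconnected)
    (hdeg : ∀ v, (G.neighborSet v).encard ≤ 2) (f : Copy (cycleGraph n) G) :
    Nonempty (G ≃g cycleGraph n) := by
  have : Nonempty (Fin n) := ⟨⟨0, by omega⟩⟩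
  refine nonempty_iso_of_copy hG f fun x w => exists_adj_of_encard_le f (Set.toFinite _) ?_
  exact (hdeg _).trans_eq (encard_neighborSet_cycleGraph hn x).symm

theorem not_nil_and_eq_snd_of_longest (hG : G.IsAcyclic) {u v w : V} {p : G.Walk u v}
    (hp : p.IsPath) (hmax : ∀ (u' v' : V) (q : G.Walk u' v'), q.IsPath → q.length ≤ p.length)
    (hw : G.Adj u w) : ¬ p.Nil ∧ w = p.snd := by
  have hmem : w ∈ p.support := by
    by_contra hnot
    have := hmax w v (p.cons hw.symm) (hp.cons hnot)
    rw [Walk.length_cons] at this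
    omega
  refine ⟨fun hnil => hw.ne' ?_, hG.eq_snd_of_adj_start hp hw hmem⟩
  rwa [Walk.nil_iff_support_eq.1 hnil, List.mem_singleton] at hmem

theorem exists_nonempty_iso_pathGraph [Finite V] (hG : G.IsTree)
    (hdeg : ∀ v, (G.neighborSet v).encard ≤ 2) : ∃ n, Nonempty (G ≃g pathGraph n) := by
  classical
  have := hG.connected.nonempty
  obtain ⟨u, v, p, hp, hmax⟩ := Walk.exists_isPath_forall_isPath_length_le_length G
  let f : Copy (pathGraph (p.length + 1)) G := hp.pathGraphCopy
  have hf (x : Fin (p.length + 1)) : f x = p.getVert x := p.support_getElem_eq_getVert _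
  refine ⟨_, nonempty_iso_of_copy hG.connected.preconnected f fun x w hw => ?_⟩
  have hw' : G.Adj (p.getVert x) w := hf x ▸ hw
  rcases Nat.eq_zero_or_pos (x : ℕ) with hx | hx
  · rw [hx, Walk.getVert_zero] at hw'
    obtain ⟨hnil, rfl⟩ := not_nil_and_eq_snd_of_longest hG.isAcyclic hp hmax hw'
    have := Walk.not_nil_iff_lt_length.1 hnil
    exact ⟨⟨1, by omega⟩, pathGraph_adj.2 (by simp [hx]), hf _⟩
  rcases (Nat.lt_succ_iff.1 x.2).eq_or_lt with hx' | hx'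
  · rw [hx', Walk.getVert_length] at hw'
    obtain ⟨-, rfl⟩ := not_nil_and_eq_snd_of_longest hG.isAcyclic hp.reverse
      (by simpa only [Walk.length_reverse] using hmax) hw'
    refine ⟨⟨p.length - 1, by omega⟩, pathGraph_adj.2 (Or.inr ?_), ?_⟩
    · simp only [hx'] at hx ⊢
      omega
    · rw [hf, Walk.snd_reverse]
  · refine exists_adj_of_encard_le f (Set.toFinite _) ?_ hw
    exact (hdeg _).trans_eq (encard_neighborSet_pathGraph hx (by omega)).symm

theorem exists_nonempty_iso_pathGraph_or_cycleGraph [Finite V] (hG : G.Connected)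
    (hdeg : ∀ v, (G.neighborSet v).encard ≤ 2) :
    (∃ n, Nonempty (G ≃g pathGraph n)) ∨ ∃ n, 3 ≤ n ∧ Nonempty (G ≃g cycleGraph n) := by
  by_cases hacyc : G.IsAcyclic
  · exact Or.inl (exists_nonempty_iso_pathGraph ⟨hG, hacyc⟩ hdeg)
  · rw [isAcyclic_iff_free_cycleGraph] at hacyc
    push Not at hacyc
    obtain ⟨n, hn, ⟨f⟩⟩ := hacyc
    exact Or.inr ⟨n, hn, nonempty_iso_cycleGraph hn hG.preconnected hdeg f⟩

end PathOrCycle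

section Branching

/-- The graphs for which the upper bound on the chromatic line index is proved: connected, of
finite chromatic number, and with a vertex of degree at least three. Infinite graphs are allowed;
the finite graphs of this kind are the connected ones that are neither a path nor a cycle. -/
structure IsBranching {V : Type*} (G : SimpleGraph V) : Prop where
  connected : G.Connected
  chromaticNumber_ne_top : G.chromaticNumber ≠ ⊤
  exists_three_le_encard : ∃ v, 3 ≤ (G.neighborSet v).encard

variable {V W : Type*} {G : SimpleGraph V} {H : SimpleGraph W}

theorem encard_neighborSet_apply (e : G ≃g H) (v : V) :
    (H.neighborSet (e v)).encard = (G.neighborSet v).encard :=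
  (ENat.card_congr (e.mapNeighborSet v)).symm

theorem isEmpty_iso_of_encard_le_two {v : V} (hv : 3 ≤ (G.neighborSet v).encard)
    (hH : ∀ w, (H.neighborSet w).encard ≤ 2) : IsEmpty (G ≃g H) := by
  refine ⟨fun e => ?_⟩
  have h : (3 : ℕ∞) ≤ 2 := hv.trans ((encard_neighborSet_apply e v).symm.trans_le (hH _))
  exact absurd h (by norm_num)

theorem chromaticNumber_ne_top_of_finite [Finite V] (G : SimpleGraph V) :
    G.chromaticNumber ≠ ⊤ :=
  chromaticNumber_ne_top_iff_exists.2 ⟨_, colorable_chromaticNumber_of_fintype G⟩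

theorem isProlific_iff :
    IsProlific G ↔ Finite V ∧ IsBranching G ∧
      IsEmpty (G ≃g completeBipartiteGraph (Fin 1) (Fin 3)) := by
  constructor
  · rintro ⟨hfin, hconn, hpath, hcycle, hstar⟩
    refine ⟨hfin, ⟨hconn, chromaticNumber_ne_top_of_finite G, ?_⟩, hstar⟩
    by_contra! hlt
    rcases exists_nonempty_iso_pathGraph_or_cycleGraph hconn
      (fun v => Order.le_of_lt_add_one (hlt v)) with ⟨n, ⟨e⟩⟩ | ⟨n, hn, ⟨e⟩⟩
    · exact (hpath n).false e
    · exact (hcycle n hn).false e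
  · rintro ⟨hfin, ⟨hconn, -, v, hv⟩, hstar⟩
    exact ⟨hfin, hconn,
      fun _ => isEmpty_iso_of_encard_le_two hv encard_neighborSet_pathGraph_le_two,
      fun _ _ => isEmpty_iso_of_encard_le_two hv encard_neighborSet_cycleGraph_le_two, hstar⟩

theorem IsProlific.isBranching (h : IsProlific G) : IsBranching G :=
  (isProlific_iff.1 h).2.1

theorem IsProlific.of_iso (e : G ≃g H) (h : IsProlific H) : IsProlific G := by
  obtain ⟨hfin, hconn, hpath, hcycle, hstar⟩ := h
  exact ⟨Finite.of_equiv _ e.toEquiv.symm, e.connected_iff.2 hconn,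
    fun n => ⟨fun f => (hpath n).false (e.symm.trans f)⟩,
    fun n hn => ⟨fun f => (hcycle n hn).false (e.symm.trans f)⟩,
    ⟨fun f => hstar.false (e.symm.trans f)⟩⟩

/-- Otherwise no edge would leave `S`, and `S` would contain `x`. -/
theorem exists_mem_three_le_encard (hG : G.Preconnected) {S : Set V} (hS : S.Nonempty)
    (hmin : ∀ v ∈ S, 2 ≤ (G.neighborSet v ∩ S).encard) {x : V}
    (hx : 3 ≤ (G.neighborSet x).encard) : ∃ v ∈ S, 3 ≤ (G.neighborSet v).encard := by
  by_cases hxS : x ∈ S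
  · exact ⟨x, hxS, hx⟩
  obtain ⟨u, hu⟩ := hS
  obtain ⟨p⟩ := hG u x
  obtain ⟨d, -, hfst, hsnd⟩ := p.exists_boundary_dart S hu hxS
  refine ⟨d.fst, hfst, ?_⟩
  calc (3 : ℕ∞) = 2 + 1 := by norm_num
    _ ≤ (G.neighborSet d.fst ∩ S).encard + 1 := by gcongr; exact hmin _ hfst
    _ = (insert d.snd (G.neighborSet d.fst ∩ S)).encard :=
        (Set.encard_insert_of_notMem fun h => hsnd h.2).symm
    _ ≤ (G.neighborSet d.fst).encard :=
        Set.encard_le_encard (Set.insert_subset d.adj Set.inter_subset_left)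

theorem exists_adj_adj_le_encard (hG : G.Preconnected) {x : V}
    (hx : 3 ≤ (G.neighborSet x).encard) {k : ℕ} (hk : 2 ≤ k) (hcol : ¬ G.Colorable k) :
    ∃ v a b, a ≠ b ∧ G.Adj v a ∧ G.Adj v b ∧ ((max 3 k : ℕ) : ℕ∞) ≤ (G.neighborSet v).encard ∧
      k ≤ (G.neighborSet a).encard ∧ k ≤ (G.neighborSet b).encard := by
  obtain ⟨S, hS, hmin⟩ := exists_finset_le_encard_of_not_colorable hcol
  have hdeg {v : V} (hv : v ∈ S) : (k : ℕ∞) ≤ (G.neighborSet v).encard :=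
    (hmin v hv).trans (Set.encard_le_encard Set.inter_subset_left)
  have hmin_two (v : V) (hv : v ∈ S) : 2 ≤ (G.neighborSet v ∩ S).encard :=
    le_trans (by exact_mod_cast hk) (hmin v hv)
  obtain ⟨v, hv, hv3⟩ := exists_mem_three_le_encard hG (S := S) hS hmin_two hx
  obtain ⟨a, b, ha, hb, hab⟩ := Set.one_lt_encard_iff.1
    (Nat.one_lt_ofNat.trans_le (hmin_two v hv))
  refine ⟨v, a, b, hab, ha.1, hb.1, ?_, hdeg ha.2, hdeg hb.2⟩
  rcases max_choice 3 k with h | h <;> rw [h]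
  exacts [hv3, hdeg hv]

theorem lt_chromaticNumber_lineGraph_three (hG : G.Preconnected) {x : V}
    (hx : 3 ≤ (G.neighborSet x).encard) {c : ℕ} (hc : 3 ≤ c) (hχ : G.chromaticNumber = c) :
    (c : ℕ∞) < G.lineGraph.lineGraph.lineGraph.chromaticNumber := by
  obtain ⟨k, rfl⟩ := Nat.exists_eq_succ_of_ne_zero (by omega : c ≠ 0)
  have hcol : ¬ G.Colorable k := fun h => by
    have : k + 1 ≤ k := by exact_mod_cast hχ ▸ h.chromaticNumber_le
    omega
  obtain ⟨v, a, b, hab, ha, hb, hdv, hda, hdb⟩ :=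
    exists_adj_adj_le_encard hG hx (by omega) hcol
  by_contra! hle
  have hbound : ((2 * max 3 k + k + k : ℕ) : ℕ∞) ≤ (k + 1 + 6 : ℕ) :=
    calc ((2 * max 3 k + k + k : ℕ) : ℕ∞)
        = 2 * (max 3 k : ℕ) + k + k := by push_cast; rfl
      _ ≤ 2 * (G.neighborSet v).encard + (G.neighborSet a).encard + (G.neighborSet b).encard := by
          gcongr
      _ ≤ G.lineGraph.lineGraph.lineGraph.chromaticNumber + 6 :=
          two_mul_encard_add_le_chromaticNumber_lineGraph_three hab ha hb
      _ ≤ (k + 1 : ℕ) + 6 := by gcongr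
  have : 2 * max 3 k + k + k ≤ k + 1 + 6 := by exact_mod_cast hbound
  omega

end Branching

section Index

variable {P : Graph.{u} → ℕ∞} {G : Graph.{u}}

theorem ind_le_of_lt {r : ℕ} (h : P G < P (iterLine G r)) : ind P G ≤ r :=
  sInf_le ⟨r, h, rfl⟩

theorem le_ind {n : ℕ} (h : ∀ r < n, P (iterLine G r) ≤ P G) : (n : ℕ∞) ≤ ind P G := by
  refine le_sInf ?_
  rintro _ ⟨r, hr, rfl⟩
  by_contra! hlt
  exact (h r (by exact_mod_cast hlt)).not_gt hr

theorem IsBranching.ind_chi_le_three {V : Type u} {G : SimpleGraph V} (hG : IsBranching G) :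
    ind chi ⟨V, G⟩ ≤ 3 := by
  obtain ⟨c, hχ⟩ := ENat.ne_top_iff_exists.1 hG.chromaticNumber_ne_top
  obtain ⟨x, hx⟩ := hG.exists_three_le_encard
  rcases Nat.lt_or_ge c 3 with hc | hc
  · refine (ind_le_of_lt (r := 1) ?_).trans (by norm_num)
    calc G.chromaticNumber = c := hχ.symm
      _ < 3 := by exact_mod_cast hc
      _ ≤ (G.neighborSet x).encard := hx
      _ ≤ G.lineGraph.chromaticNumber := encard_neighborSet_le_chromaticNumber_lineGraph x
  · exact ind_le_of_lt (r := 3)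
      (hχ.symm.trans_lt
        (lt_chromaticNumber_lineGraph_three hG.connected.preconnected hx hc hχ.symm))

theorem nonempty_iso_iterLine {G H : Graph} (e : G.2 ≃g H.2) (r : ℕ) :
    Nonempty ((iterLine G r).2 ≃g (iterLine H r).2) := by
  induction r with
  | zero => exact ⟨e⟩
  | succ r ih =>
    obtain ⟨f⟩ := ih
    exact ⟨f.lineGraph⟩

theorem chi_congr {G H : Graph} (e : G.2 ≃g H.2) : chi G = chi H :=
  chromaticNumber_congr e

theorem ind_chi_congr {G H : Graph} (e : G.2 ≃g H.2) : ind chi G = ind chi H := by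
  have hiter (r : ℕ) : chi (iterLine G r) = chi (iterLine H r) :=
    chi_congr (nonempty_iso_iterLine e r).some
  simp only [ind, chi_congr e, hiter]

end Index

section CP

variable {k l : ℕ}

theorem CP_adj {i j : Fin (k + l)} : (CP k l).Adj i j ↔ (i : ℕ) ≠ j ∧
    ((i : ℕ) + 1 = j ∨ (j : ℕ) + 1 = i ∨
      ((i : ℕ) = 0 ∧ (j : ℕ) + 1 = k) ∨ ((j : ℕ) = 0 ∧ (i : ℕ) + 1 = k)) := by
  rw [CP, fromRel_adj, ne_eq, Fin.ext_iff]
  omega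

theorem CP_connected (h : 0 < k + l) : (CP k l).Connected := by
  obtain ⟨n, hn⟩ := Nat.exists_eq_succ_of_ne_zero h.ne'
  have hpath : (pathGraph (k + l)).Connected := by
    rw [hn]
    exact pathGraph_connected n
  refine hpath.mono fun i j hij => ?_
  rw [pathGraph_adj] at hij
  rw [CP_adj]
  omega

theorem three_le_encard_neighborSet_CP (hk : 3 ≤ k) (hl : 1 ≤ l) :
    3 ≤ ((CP k l).neighborSet ⟨k - 1, by omega⟩).encard := by
  let first : Fin (k + l) := ⟨0, by omega⟩
  let prev : Fin (k + l) := ⟨k - 2, by omega⟩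
  let next : Fin (k + l) := ⟨k, by omega⟩
  have hencard : ({first, prev, next} : Set (Fin (k + l))).encard = 3 := by
    refine Set.encard_eq_three.2 ⟨first, prev, next, ?_, ?_, ?_, rfl⟩ <;>
      simp only [first, prev, next, ne_eq, Fin.mk.injEq] <;> omega
  rw [← hencard]
  refine Set.encard_le_encard ?_
  simp only [first, prev, next, Set.insert_subset_iff, Set.singleton_subset_iff, mem_neighborSet,
    CP_adj]
  lia

theorem eq_or_eq_of_completeBipartiteGraph_adj {α β : Type*} [Subsingleton α] {a b c d : α ⊕ β}
    (hab : (completeBipartiteGraph α β).Adj a b) (hcd : (completeBipartiteGraph α β).Adj c d) :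
    a = c ∨ a = d ∨ b = c ∨ b = d := by
  rw [completeBipartiteGraph_adj] at hab hcd
  have hcenter {x y : α ⊕ β} (hx : x.isLeft) (hy : y.isLeft) : x = y := by
    obtain ⟨x, rfl⟩ := Sum.isLeft_iff.1 hx
    obtain ⟨y, rfl⟩ := Sum.isLeft_iff.1 hy
    rw [Subsingleton.elim x y]
  rcases hab with ⟨ha, -⟩ | ⟨-, hb⟩ <;> rcases hcd with ⟨hc, -⟩ | ⟨-, hd⟩
  · exact Or.inl (hcenter ha hc)
  · exact Or.inr (Or.inl (hcenter ha hd))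
  · exact Or.inr (Or.inr (Or.inl (hcenter hb hc)))
  · exact Or.inr (Or.inr (Or.inr (hcenter hb hd)))

/-- The edges `{0, 1}` and `{k - 1, k}` are disjoint, while any two edges of a star meet. -/
theorem isEmpty_iso_CP_star (hk : 3 ≤ k) (hl : 1 ≤ l) {α β : Type*} [Subsingleton α] :
    IsEmpty (CP k l ≃g completeBipartiteGraph α β) := by
  refine ⟨fun e => ?_⟩
  have hfirst : (CP k l).Adj ⟨0, by omega⟩ ⟨1, by omega⟩ := CP_adj.2 (by simp)
  have hlast : (CP k l).Adj ⟨k - 1, by omega⟩ ⟨k, by omega⟩ :=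
    CP_adj.2 (by simp only; omega)
  have := eq_or_eq_of_completeBipartiteGraph_adj (e.map_adj_iff.2 hfirst) (e.map_adj_iff.2 hlast)
  simp only [e.injective.eq_iff, Fin.mk.injEq] at this
  omega

theorem CP_isProlific (hk : 3 ≤ k) (hl : 1 ≤ l) : IsProlific (CP k l) :=
  isProlific_iff.2 ⟨inferInstance, ⟨CP_connected (by omega), chromaticNumber_ne_top_of_finite _,
    _, three_le_encard_neighborSet_CP hk hl⟩, isEmpty_iso_CP_star hk hl⟩

theorem three_le_chromaticNumber_CP_three : 3 ≤ (CP 3 l).chromaticNumber := by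
  refine le_chromaticNumber_of_pairwise_adj (ι := Fin 3) (n := 3) (by simp)
    (fun i => Fin.castLE (by omega) i) fun i j hij => ?_
  have := Fin.val_ne_of_ne hij
  change (CP 3 l).Adj _ _
  rw [CP_adj, Fin.val_castLE, Fin.val_castLE]
  omega

end CP

section ChordedRay

/-- The ray `0, 1, 2, …` together with the chords joining `m` and `m + 2` for `m < k`. The ray with
one chord contains every `CP 3 l`, and the ray with two chords contains its line graph. -/
def chordedRay (k : ℕ) : SimpleGraph ℕ :=
  fromRel fun m n => m + 1 = n ∨ (m < k ∧ n = m + 2)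

/-- The labelling `0, 1, 2, 3, 4, …` of the edges `01, 02, 12, 23, 34, …` of `chordedRay 1`. -/
def edgeLabel (e : Sym2 ℕ) : ℕ :=
  if e.inf = 0 then e.sup - 1 else e.sup

variable {k l : ℕ}

theorem chordedRay_adj {m n : ℕ} : (chordedRay k).Adj m n ↔
    m + 1 = n ∨ n + 1 = m ∨ (m < k ∧ n = m + 2) ∨ (n < k ∧ m = n + 2) := by
  rw [chordedRay, fromRel_adj]
  omega

theorem CP_three_isContained_chordedRay_one : CP 3 l ⊑ chordedRay 1 := by
  let f : CP 3 l →g chordedRay 1 :=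
    { toFun i := i
      map_rel' {i j} h := by
        rw [CP_adj] at h
        rw [chordedRay_adj]
        omega }
  exact ⟨⟨f, Fin.val_injective⟩⟩

theorem edgeLabel_mk (m n : ℕ) : edgeLabel s(m, n) = if min m n = 0 then max m n - 1 else max m n :=
  rfl

theorem edgeLabel_injOn : Set.InjOn edgeLabel (chordedRay 1).edgeSet := by
  intro e he e' he' h
  induction e using Sym2.ind with | _ a b
  induction e' using Sym2.ind with | _ c d
  rw [mem_edgeSet, chordedRay_adj] at he he'
  rw [edgeLabel_mk, edgeLabel_mk] at h
  rw [Sym2.eq_iff]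
  grind

theorem lineGraph_chordedRay_one_isContained : (chordedRay 1).lineGraph ⊑ chordedRay 2 := by
  let f : (chordedRay 1).lineGraph →g chordedRay 2 :=
    { toFun e := edgeLabel e
      map_rel' {e e'} h := by
        obtain ⟨a, b, c, hb, hc, hbc, he, he'⟩ := exists_eq_mk_of_lineGraph_adj h
        rw [chordedRay_adj] at hb hc ⊢
        rw [he, he', edgeLabel_mk, edgeLabel_mk]
        grind }
  exact ⟨⟨f, edgeLabel_injOn.injective⟩⟩

theorem colorable_three_chordedRay : (chordedRay k).Colorable 3 := by
  refine colorable_iff_exists_bdd_nat_coloring 3 |>.2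
    ⟨Coloring.mk (fun m => m % 3) fun {m n} h => ?_, fun m => Nat.mod_lt m (by norm_num)⟩
  rw [chordedRay_adj] at h
  omega

/-- The edges of the ray are coloured alternately, and the two chords, which are disjoint, get the
third colour. -/
theorem colorable_three_lineGraph_chordedRay_two : (chordedRay 2).lineGraph.Colorable 3 := by
  let color (e : Sym2 ℕ) : ℕ := if e.inf + 1 = e.sup then e.inf % 2 else 2
  have hcolor (m n : ℕ) :
      color s(m, n) = if min m n + 1 = max m n then min m n % 2 else 2 := rfl
  refine colorable_iff_exists_bdd_nat_coloring 3 |>.2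
    ⟨Coloring.mk (fun e => color e) fun {e e'} h => ?_, fun e => ?_⟩
  · obtain ⟨a, b, c, hb, hc, hbc, he, he'⟩ := exists_eq_mk_of_lineGraph_adj h
    rw [chordedRay_adj] at hb hc
    rw [he, he', hcolor, hcolor]
    grind
  · change color e < 3
    grind

theorem colorable_three_lineGraph_CP_three : (CP 3 l).lineGraph.Colorable 3 :=
  have ⟨f⟩ := CP_three_isContained_chordedRay_one.lineGraph.trans
    lineGraph_chordedRay_one_isContained
  colorable_three_chordedRay.of_hom f.toHom

theorem colorable_three_lineGraph_lineGraph_CP_three : (CP 3 l).lineGraph.lineGraph.Colorable 3 :=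
  have ⟨f⟩ := (CP_three_isContained_chordedRay_one.lineGraph.trans
    lineGraph_chordedRay_one_isContained).lineGraph
  colorable_three_lineGraph_chordedRay_two.of_hom f.toHom

theorem ind_chi_CP_three (hl : 1 ≤ l) : ind chi ⟨_, CP 3 l⟩ = 3 := by
  refine (CP_isProlific le_rfl hl).isBranching.ind_chi_le_three.antisymm
    (le_ind (n := 3) fun r hr => ?_)
  interval_cases r
  · exact le_rfl
  · exact colorable_three_lineGraph_CP_three.chromaticNumber_le.trans
      three_le_chromaticNumber_CP_three
  · exact colorable_three_lineGraph_lineGraph_CP_three.chromaticNumber_le.trans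
      three_le_chromaticNumber_CP_three

end ChordedRay

end LineIndex

open LineIndex in
theorem theoremH_general :
    (∀ (V : Type u) (G : SimpleGraph V), IsBranching G → ind chi ⟨V, G⟩ ≤ 3) ∧
    (∀ n : ℕ, 4 ≤ n → IsProlific (CP 3 (n - 3)) ∧ ind chi ⟨_, CP 3 (n - 3)⟩ = 3) ∧
    {n : ℕ | ∃ G : SimpleGraph (Fin n), IsProlific G ∧ ind chi ⟨_, G⟩ = 3}.Infinite ∧
    ∀ F : Set Graph.{u}, prolificGraphs ⊆ F → (∀ G ∈ F, IsBranching G.2) →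
      familyIndex chi F = 3 := by
  have hCP (l : ℕ) (hl : 1 ≤ l) : IsProlific (CP 3 l) ∧ ind chi ⟨_, CP 3 l⟩ = 3 :=
    ⟨CP_isProlific le_rfl hl, ind_chi_CP_three hl⟩
  refine ⟨fun V G hG => hG.ind_chi_le_three, fun n hn => hCP _ (by omega), ?_, fun F hF hbr => ?_⟩
  · exact Set.infinite_of_injective_forall_mem (f := fun m : ℕ => 3 + (m + 1))
      (fun a b h => by simpa using h) fun m => ⟨CP 3 (m + 1), hCP _ (by omega)⟩
  refine (iSup₂_le fun G hG => (hbr G hG).ind_chi_le_three).antisymm ?_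
  let G : Graph.{u} := ⟨ULift (Fin (3 + 1)), (CP 3 1).comap Equiv.ulift⟩
  let e : G.2 ≃g CP 3 1 := SimpleGraph.Iso.comap Equiv.ulift _
  calc 3 = ind chi ⟨_, CP 3 1⟩ := (ind_chi_CP_three le_rfl).symm
    _ = ind chi G := (ind_chi_congr (H := ⟨_, CP 3 1⟩) e).symm
    _ ≤ familyIndex chi F := le_iSup₂_of_le G (hF ((CP_isProlific le_rfl le_rfl).of_iso e)) le_rfl

theorem theoremH :
    (∀ (V : Type u) (G : SimpleGraph V), LineIndex.IsProlific G →
      LineIndex.ind LineIndex.chi ⟨V, G⟩ ≤ 3) ∧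
    (∀ n : ℕ, 4 ≤ n → LineIndex.IsProlific (LineIndex.CP 3 (n - 3)) ∧
      LineIndex.ind LineIndex.chi ⟨_, LineIndex.CP 3 (n - 3)⟩ = 3) ∧
    {n : ℕ | ∃ G : SimpleGraph (Fin n), LineIndex.IsProlific G ∧
      LineIndex.ind LineIndex.chi ⟨_, G⟩ = 3}.Infinite ∧
    LineIndex.familyIndex LineIndex.chi LineIndex.prolificGraphs.{u} = 3 :=
  have ⟨hle, hCP, hinf, hindex⟩ := theoremH_general.{u}
  ⟨fun V G hG => hle V G hG.isBranching, hCP, hinf,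
    hindex _ subset_rfl fun _ => LineIndex.IsProlific.isBranching⟩
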